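/- For cardinals $\theta\ge\kappa$ let $[\theta]^{\kappa}$ be the set of subsets of $\theta$ of cardinality $\kappa$. A family $\mathcal F\subseteq[\theta]^\kappa$ is cofinal if every $X\in[\theta]^\kappa$ is contained in some member of $\mathcal F$, and $\mathrm{cov}(\theta,\kappa)$ is the least size of a cofinal family. A family of sets $\mathcal F$ is $(\mu,\kappa)$-sparse if $|\bigcup\mathcal G|\ge\kappa$ for every $\mathcal G\subseteq\mathcal F$ with $|\mathcal G|\ge\mu$. For $f,g:\omega\to\mathrm{On}$ write $f<^*g$ (resp. $f\le^*g$) if $f(n)<g(n)$ (resp. $f(n)\le g(n)$) for all but finitely many $n$. A scale of length $\lambda$ in $(\prod_n\aleph_n,\le^*)$ is a $<^*$-increasing sequence $\langle f_\alpha:\alpha<\lambda\rangle$ in $\prod_{n\in\omega}\aleph_n$ that is cofinal with respect to $\le^*$. It is good if for every $\beta<\lambda$ with $\mathrm{cf}(\beta)>\aleph_0$: (a) $\langle f_\alpha:\alpha<\beta\rangle$ is flat, i.e. there are $h_i:\omega\to\mathrm{On}$ ($i<\mathrm{cf}(\beta)$) with $h_i(n)<h_j(n)$ for all $i<j$ and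 all $n$, such that every $h_i$ is $<^*$ some $f_\alpha$ ($\alpha<\beta$) and every $f_\alpha$ ($\alpha<\beta$) is $<^*$ some $h_i$; and (b) $f_\beta$ is an exact upper bound of $\langle f_\alpha:\alpha<\beta\rangle$, i.e. $f_\alpha<^*f_\beta$ for all $\alpha<\beta$, and every $g<^*f_\beta$ satisfies $g<^*f_\alpha$ for some $\alpha<\beta$. $\square_{\kappa}$ is the statement that there is a sequence $\langle C_\alpha:\alpha<\kappa^+\text{ limit}\rangle$ such that $C_\alpha$ is a club in $\alpha$ of order type at most $\kappa$, and $C_\beta=C_\alpha\cap\beta$ for every limit point $\beta<\alpha$ of $C_\alpha$. The Noetherian type $\mathrm{Nt}(X)$ of a space $X$ is the least infinite cardinal $\kappa$ such that $X$ has a base $\mathcal B$ every member of which has fewer than $\kappa$ supersets in $\mathcal B$. $(2^{\aleph_\omega})_\delta$ is the Cantor cube $2^{\aleph_\omega}$ with the topology generated by the countable intersections of open sets of the product topology. Then: 1. If $\langle f_\alpha:\alpha<\aleph_{\omega+1}\rangle$ is a good scale in $(\prod_n\aleph_n,\le^*)$, then the family of ranges $\{\mathrm{ran} f_\alpha:\alpha<\aleph_{\omega+1}\}$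 is $(\aleph_1,\aleph_1)$-sparse. 2. If $\mathrm{cov}(\aleph_\omega,\aleph_0)=\aleph_{\omega+1}$ and there is a good scale of length $\aleph_{\omega+1}$ in $(\prod_n\aleph_n,\le^*)$, then there is an $(\aleph_1,\aleph_1)$-sparse cofinal family in $[\aleph_\omega]^{\aleph_0}$. 3. If $\square_{\aleph_\omega}$ and $\mathrm{cov}(\aleph_\omega,\aleph_0)=\aleph_{\omega+1}$ hold, then $\mathrm{Nt}((2^{\aleph_\omega})_\delta)=\aleph_1$. -/

import Mathlib

open scoped Cardinal Ordinal Topology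

universe u v

/-! ### Families of sets -/

/-- `[θ]^κ`: the subsets of cardinality `κ` of the cardinal `θ`, where `θ` is regarded, as usual,
as the set of all ordinals below the initial ordinal `θ.ord`. -/
def subsetsOfCard (θ κ : Cardinal.{u}) : Set (Set Ordinal.{u}) :=
  {X | X ⊆ Set.Iio θ.ord ∧ Cardinal.mk X = Cardinal.lift.{u + 1} κ}

/-- `𝓐` is a cofinal (covering) family in `([θ]^κ, ⊆)`. -/
def IsCofinalFamily (θ κ : Cardinal.{u}) (𝓐 : Set (Set Ordinal.{u})) : Prop :=
  𝓐 ⊆ subsetsOfCard θ κ ∧ ∀ X ∈ subsetsOfCard θ κ, ∃ Y ∈ 𝓐, X ⊆ Y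

/-- `cov(θ, κ)`: the least size of a cofinal family in `([θ]^κ, ⊆)`. The infimum is over a nonempty
set, since `[θ]^κ` itself is such a family. -/
noncomputable def cov (θ κ : Cardinal.{u}) : Cardinal.{u + 1} :=
  sInf {c | ∃ 𝓐 : Set (Set Ordinal.{u}), IsCofinalFamily θ κ 𝓐 ∧ Cardinal.mk 𝓐 = c}

/-- A family of sets is `κ`-small if its union has fewer than `κ` elements. -/
def IsSmallFamily {α : Type v} (κ : Cardinal.{v}) (𝓖 : Set (Set α)) : Prop :=
  Cardinal.mk (⋃₀ 𝓖) < κ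

/-- A family of sets is `(μ, κ)`-sparse if no subfamily of size at least `μ` is `κ`-small. -/
def IsSparseFamily {α : Type v} (μ κ : Cardinal.{v}) (𝓕 : Set (Set α)) : Prop :=
  ∀ 𝓖 ⊆ 𝓕, μ ≤ Cardinal.mk 𝓖 → ¬ IsSmallFamily κ 𝓖

/-! ### Scales

Transfinite sequences of length `l` are given by functions on all ordinals, of which only the
values below `l` matter. -/

/-- `f <_U g`. -/
def ltMod (U : Filter ℕ) (f g : ℕ → Ordinal.{u}) : Prop := ∀ᶠ n in U, f n < g n

/-- `f ≤_U g`. For `U` the cofinite filter this is `f ≤* g`. -/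
def leMod (U : Filter ℕ) (f g : ℕ → Ordinal.{u}) : Prop := ∀ᶠ n in U, f n ≤ g n

/-- `⟨f α : α < l⟩` is `<_U`-increasing. -/
def IsIncreasingMod (U : Filter ℕ) (l : Ordinal.{u}) (f : Ordinal.{u} → ℕ → Ordinal.{u}) : Prop :=
  ∀ α β, α < β → β < l → ltMod U (f α) (f β)

/-- `g` is an exact upper bound of `⟨f α : α < l⟩` with respect to `<_U`. -/
def IsExactUpperBound (U : Filter ℕ) (l : Ordinal.{u}) (f : Ordinal.{u} → ℕ → Ordinal.{u})
    (g : ℕ → Ordinal.{u}) : Prop :=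
  (∀ α < l, ltMod U (f α) g) ∧
    ∀ g' : ℕ → Ordinal.{u}, ltMod U g' g → ∃ α < l, ltMod U g' (f α)

/-- The `<_U`-increasing sequence `⟨f α : α < l⟩`, where `l` has uncountable cofinality, is flat:
it is interleaved modulo `U` with a sequence `⟨h i : i < cf l⟩` of ordinal functions which is
strictly increasing at every coordinate. -/
def IsFlat (U : Filter ℕ) (l : Ordinal.{u}) (f : Ordinal.{u} → ℕ → Ordinal.{u}) : Prop :=
  ℵ₀ < l.cof ∧ IsIncreasingMod U l f ∧
    ∃ h : Ordinal.{u} → ℕ → Ordinal.{u},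
      (∀ i j, i < j → j < l.cof.ord → ∀ n, h i n < h j n) ∧
      (∀ i < l.cof.ord, ∃ α < l, ltMod U (h i) (f α)) ∧
      (∀ α < l, ∃ i < l.cof.ord, ltMod U (f α) (h i))

/-- The product `∏ₙ ℵₙ`. -/
def prodAlephs : Set (ℕ → Ordinal.{u}) := {g | ∀ n : ℕ, g n < ω_ (n : Ordinal.{u})}

/-- `⟨f α : α < l⟩` is a scale in `∏ₙ ℵₙ / U`: it is `<_U`-increasing and cofinal. -/
def IsScale (U : Filter ℕ) (l : Ordinal.{u}) (f : Ordinal.{u} → ℕ → Ordinal.{u}) : Prop :=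
  (∀ α < l, f α ∈ prodAlephs) ∧ IsIncreasingMod U l f ∧
    ∀ g ∈ prodAlephs, ∃ α < l, leMod U g (f α)

/-- A scale is good if at every `β < l` of uncountable cofinality its restriction to `β` is flat
and has `f β` as an exact upper bound. -/
def IsGoodScale (U : Filter ℕ) (l : Ordinal.{u}) (f : Ordinal.{u} → ℕ → Ordinal.{u}) : Prop :=
  IsScale U l f ∧
    ∀ β < l, ℵ₀ < β.cof → IsFlat U β f ∧ IsExactUpperBound U β f (f β)

/-! ### Jensen's square principle -/

/-- `β` is a limit point of `C`: a nonzero ordinal which is the supremum of `C ∩ β`. -/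
def IsLimitPoint (β : Ordinal.{u}) (C : Set Ordinal.{u}) : Prop :=
  β ≠ 0 ∧ ∀ γ < β, ∃ δ ∈ C, γ < δ ∧ δ < β

/-- `C` is closed and unbounded in the limit ordinal `α`. -/
def IsClubIn (C : Set Ordinal.{u}) (α : Ordinal.{u}) : Prop :=
  C ⊆ Set.Iio α ∧ (∀ β < α, ∃ γ ∈ C, β < γ) ∧ ∀ β < α, IsLimitPoint β C → β ∈ C

/-- `□_κ`: there is a sequence `⟨C α : α < κ⁺ limit⟩` such that every `C α` is a club in `α` of
order type at most `κ`, and `C β = C α ∩ β` for all limit points `β < α` of `C α`. -/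
def SquarePrinciple (κ : Cardinal.{u}) : Prop :=
  ∃ C : Ordinal.{u} → Set Ordinal.{u},
    ∀ α < (Order.succ κ).ord, Order.IsSuccLimit α →
      IsClubIn (C α) α ∧
      Ordinal.type (fun x y : C α => x < y) ≤ Ordinal.lift.{u + 1} κ.ord ∧
      ∀ β < α, IsLimitPoint β (C α) → C β = C α ∩ Set.Iio β

/-! ### Noetherian type -/

/-- The family `𝓑` is `κ^op`-like: every member of `𝓑` has fewer than `κ` supersets in `𝓑`. -/
def IsOpLike {X : Type v} (κ : Cardinal.{v}) (𝓑 : Set (Set X)) : Prop :=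
  ∀ B ∈ 𝓑, Cardinal.mk {V : Set X | V ∈ 𝓑 ∧ B ⊆ V} < κ

/-- The Noetherian type of the space `(X, t)`: the least infinite cardinal `κ` such that some base
is `κ^op`-like. (The infimum is over a nonempty set: take `κ` larger than the number of open
sets.) -/
noncomputable def noetherianType {X : Type v} (t : TopologicalSpace X) : Cardinal.{v} :=
  sInf {κ | ℵ₀ ≤ κ ∧
    ∃ 𝓑 : Set (Set X), TopologicalSpace.IsTopologicalBasis (t := t) 𝓑 ∧ IsOpLike κ 𝓑}

/-- The topology of `X_θ`, generated by all intersections of fewer than `θ` open sets of `X`. -/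
abbrev intersectionModification {X : Type v} (t : TopologicalSpace X) (θ : Cardinal.{v}) :
    TopologicalSpace X :=
  TopologicalSpace.generateFrom
    {s | ∃ 𝓢 : Set (Set X), (∀ U ∈ 𝓢, IsOpen[t] U) ∧ Cardinal.mk 𝓢 < θ ∧ s = ⋂₀ 𝓢}

/-- The topology of `X_δ = X_{ℵ₁}`, the `G_δ`-modification of `X`. -/
noncomputable abbrev deltaModification {X : Type v} (t : TopologicalSpace X) : TopologicalSpace X :=
  intersectionModification t ℵ₁

/-- The points of the Cantor cube `2^κ`, which carries the product topology. -/
abbrev CantorCube (κ : Cardinal.{u}) : Type (u + 1) := Set.Iio κ.ord → Bool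

namespace SparseFamily

open Set Filter Order

/-! ### Uncountable unions of ranges -/

/-! Suppose uncountably many indices have ranges with countable union. Pass to an index set `J` of
size `ℵ₁` and take the least `β` for which `J ∩ β` is uncountable; then `cf β > ℵ₀`, and `β` is
below the length of the sequence, whose cofinality exceeds `ℵ₁`. Let `h` witness flatness at `β`.
Only countably many values occur, so a single `h k` exceeds each value that any `h j` exceeds at the
same coordinate. As `h k <* f γ` for some `γ < β`, no index of `J ∩ β` lies above `γ`, against the
minimality of `β` (`exists_bound_of_isWeaklyFlat`, `not_countable_iUnion_range`).

For a sparse cofinal family, adjoin `range (f α)` to the `α`-th member of a cofinal family of size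
`ℵ_{ω+1}`.

Under square no scale is needed: a recursion along the square sequence gives a `<*`-increasing
sequence that is weakly flat at every point of uncountable cofinality
(`exists_sparse_sequence_of_square`), and this suffices for sparseness. The cylinders supported on
members of the resulting family form a base of the `G_δ`-topology. Larger cylinders have smaller
supports, and sparseness leaves only countably many of these. Conversely, closure of the topology
under countable intersections rules out `ℵ₀`. -/

theorem countable_iff_mk_lt_aleph_one {α : Type v} {s : Set α} : s.Countable ↔ #s < ℵ₁ := by
  rw [Cardinal.lt_aleph_one_iff, Cardinal.le_aleph0_iff_set_countable]

theorem exists_gt_of_mk_lt_cof {a : Ordinal.{u}} {S : Set Ordinal.{u}} (hS : ∀ i ∈ S, i < a)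
    (h : #S < (Ordinal.lift.{u + 1} a).cof) : ∃ b < a, ∀ i ∈ S, i < b := by
  refine ⟨_, Ordinal.sSup_add_one_lt_of_lt_cof h hS, fun i hi => ?_⟩
  have hb : BddAbove ((· + 1) '' S) := by
    refine ⟨a, ?_⟩
    rintro _ ⟨j, hj, rfl⟩
    exact Order.add_one_le_of_lt (hS j hj)
  exact (lt_add_one i).trans_le (le_csSup hb ⟨i, hi, rfl⟩)

theorem exists_gt_of_countable {a : Ordinal.{u}} (ha : ℵ₀ < a.cof) {S : Set Ordinal.{u}}
    (hS : ∀ i ∈ S, i < a) (h : S.Countable) : ∃ b < a, ∀ i ∈ S, i < b := by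
  refine exists_gt_of_mk_lt_cof hS ?_
  rw [← Ordinal.lift_cof]
  refine (Cardinal.le_aleph0_iff_set_countable.2 h).trans_lt (Cardinal.aleph0_lt_lift.2 ha)

theorem exists_countable_cofinal {a : Ordinal.{u}} (ha : a.cof ≤ ℵ₀) :
    ∃ S : Set Ordinal.{u}, S.Countable ∧ S ⊆ Iio a ∧ ∀ b < a, ∃ c ∈ S, b ≤ c := by
  obtain ⟨s, hs, hcard⟩ := Order.exists_cof_eq (Iio a)
  rw [Ordinal.cof_Iio, ← Ordinal.lift_cof] at hcard
  refine ⟨Subtype.val '' s, Set.Countable.image ?_ _, ?_, fun b hb => ?_⟩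
  · rw [← Cardinal.le_aleph0_iff_set_countable, hcard]
    exact Cardinal.lift_le_aleph0.2 ha
  · rintro _ ⟨x, -, rfl⟩
    exact x.2
  · obtain ⟨c, hc, hbc⟩ := hs ⟨b, hb⟩
    exact ⟨c, ⟨c, hc, rfl⟩, hbc⟩

/-- A weakening of flatness: the sequence `⟨f α : α < β⟩` is interleaved with a family, indexed by
a countably directed set of ordinals, that is increasing at every coordinate from some point on. -/
def IsWeaklyFlat (β : Ordinal.{u}) (f : Ordinal.{u} → ℕ → Ordinal.{u}) : Prop :=
  ∃ (D : Set Ordinal.{u}) (N : ℕ) (h : Ordinal.{u} → ℕ → Ordinal.{u}),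
    (∀ S ⊆ D, S.Countable → ∃ j ∈ D, ∀ i ∈ S, i ≤ j) ∧
    (∀ i ∈ D, ∀ j ∈ D, i ≤ j → ∀ n, N ≤ n → h i n ≤ h j n) ∧
    (∀ i ∈ D, ∃ α < β, ltMod cofinite (h i) (f α)) ∧
    (∀ α < β, ∃ i ∈ D, ltMod cofinite (f α) (h i))

theorem isWeaklyFlat_of_isFlat {β : Ordinal.{u}} {f : Ordinal.{u} → ℕ → Ordinal.{u}}
    (hf : IsFlat cofinite β f) : IsWeaklyFlat β f := by
  obtain ⟨hβ, -, h, hmono, hlow, hupp⟩ := hf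
  refine ⟨Iio β.cof.ord, 0, h, fun S hS hc => ?_, fun i _ j hj hij n _ => ?_, hlow, hupp⟩
  · obtain ⟨b, hb, hSb⟩ := exists_gt_of_countable (by rwa [Ordinal.cof_ord_cof]) hS hc
    exact ⟨b, hb, fun i hi => (hSb i hi).le⟩
  · rcases hij.eq_or_lt with rfl | hlt
    · exact le_rfl
    · exact (hmono i j hlt hj n).le

/-- Below a weakly flat point, an index set whose functions take only countably many values is
bounded. -/
theorem exists_bound_of_isWeaklyFlat {β : Ordinal.{u}} {f : Ordinal.{u} → ℕ → Ordinal.{u}}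
    (hinc : IsIncreasingMod cofinite β f) (hf : IsWeaklyFlat β f) {J : Set Ordinal.{u}}
    (hJ : J ⊆ Iio β) (hc : (⋃ α ∈ J, range (f α)).Countable) : ∃ γ < β, J ⊆ Iic γ := by
  obtain ⟨D, N, h, hdir, hmono, hlow, hupp⟩ := hf
  set U := ⋃ α ∈ J, range (f α)
  -- Pairs of a coordinate and a value overtaken there by some `h j`. There are countably many, so
  -- countable directedness gives one `k` above all the chosen `j`.
  let P : Set (ℕ × Ordinal.{u}) := {p | p.2 ∈ U ∧ ∃ j ∈ D, p.2 < h j p.1}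
  have hP : P.Countable :=
    ((countable_univ (α := ℕ)).prod hc).mono fun p hp => mk_mem_prod (mem_univ p.1) hp.1
  choose! j hjD hj using fun p (hp : p ∈ P) => hp.2
  obtain ⟨k, hkD, hk⟩ := hdir (j '' P) (by rintro _ ⟨p, hp, rfl⟩; exact hjD p hp) (hP.image j)
  obtain ⟨γ, hγ, hkγ⟩ := hlow k hkD
  refine ⟨γ, hγ, fun α hα => ?_⟩
  by_contra hlt
  rw [mem_Iic, not_le] at hlt
  obtain ⟨i, hiD, hi⟩ := hupp α (hJ hα)
  have hγα := hinc γ α hlt (hJ hα)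
  have hN : ∀ᶠ n in cofinite, N ≤ n := by
    rw [Nat.cofinite_eq_atTop]
    exact eventually_ge_atTop N
  -- At such an `n`, `f α n < h k n < f γ n < f α n`.
  obtain ⟨n, h₁, h₂, h₃, h₄⟩ := (hi.and (hkγ.and (hγα.and hN))).exists
  have hp : (n, f α n) ∈ P := ⟨mem_biUnion hα (mem_range_self n), i, hiD, h₁⟩
  have h₅ : f α n < h (j (n, f α n)) n := hj _ hp
  have h₆ := hmono _ (hjD _ hp) k hkD (hk _ ⟨_, hp, rfl⟩) n h₄
  exact (h₅.trans_le (h₆.trans (h₂.trans h₃).le)).false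

theorem not_countable_iUnion_range {l : Ordinal.{u}} {f : Ordinal.{u} → ℕ → Ordinal.{u}}
    (hl : ℵ₁ < l.cof) (hinc : IsIncreasingMod cofinite l f)
    (hflat : ∀ β < l, ℵ₀ < β.cof → IsWeaklyFlat β f) {I : Set Ordinal.{u}} (hI : I ⊆ Iio l)
    (hIc : ¬ I.Countable) : ¬ (⋃ α ∈ I, range (f α)).Countable := by
  intro hc
  -- Size exactly `ℵ₁` makes `J` bounded below `l`, since `ℵ₁ < l.cof`.
  obtain ⟨J, hJI, hJ⟩ := Cardinal.le_mk_iff_exists_subset.1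
    (show ℵ₁ ≤ #I by rwa [← not_lt, ← countable_iff_mk_lt_aleph_one])
  have hJc : ¬ J.Countable := by
    rw [countable_iff_mk_lt_aleph_one, hJ]
    exact lt_irrefl _
  obtain ⟨b, hb, hJb⟩ : ∃ b < l, ∀ i ∈ J, i < b := by
    refine exists_gt_of_mk_lt_cof (fun i hi => hI (hJI hi)) ?_
    rw [hJ, ← Ordinal.lift_cof]
    exact Cardinal.aleph_one_lt_lift.2 hl
  have hbc : ¬ (J ∩ Iio b).Countable := by
    rwa [inter_eq_left.2 (show J ⊆ Iio b from hJb)]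
  obtain ⟨β, hβ, hmin⟩ := WellFounded.has_min (r := ((· < ·) : Ordinal → Ordinal → Prop))
    wellFounded_lt {β | ¬ (J ∩ Iio β).Countable} ⟨b, hbc⟩
  have hmin' : ∀ γ < β, (J ∩ Iic γ).Countable := by
    intro γ hγ
    have h₁ : (J ∩ Iio γ).Countable := by
      by_contra h
      exact hmin γ h hγ
    refine (h₁.insert γ).mono ?_
    rintro x ⟨hx, hxγ⟩
    rcases eq_or_lt_of_le (mem_Iic.1 hxγ) with rfl | hlt
    · exact mem_insert _ _
    · exact mem_insert_of_mem _ ⟨hx, hlt⟩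
  have hβl : β < l := (not_lt.1 (hmin b hbc)).trans_lt hb
  have hcof : ℵ₀ < β.cof := by
    by_contra hle
    obtain ⟨S, hSc, hSβ, hS⟩ := exists_countable_cofinal (not_lt.1 hle)
    refine hβ (Countable.mono ?_ (hSc.biUnion fun γ hγ => hmin' γ (hSβ hγ)))
    rintro x ⟨hx, hxβ⟩
    obtain ⟨c, hc, hxc⟩ := hS x hxβ
    exact mem_biUnion hc (show x ∈ J ∩ Iic c from ⟨hx, hxc⟩)
  obtain ⟨γ, hγ, hsub⟩ := exists_bound_of_isWeaklyFlat
    (fun α δ hαδ hδ => hinc α δ hαδ (hδ.trans hβl)) (hflat β hβl hcof)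
    (J := J ∩ Iio β) inter_subset_right
    (hc.mono (biUnion_subset_biUnion_left fun x hx => hJI hx.1))
  exact hβ ((hmin' γ hγ).mono fun x hx => mem_inter hx.1 (hsub hx))

/-- If uncountably many of the ranges of the `f α` always have an uncountable union, then any
family of sets indexed by ordinals below `l` and containing these ranges is sparse. -/
theorem isSparseFamily_of_range_subset {l : Ordinal.{u}} {f : Ordinal.{u} → ℕ → Ordinal.{u}}
    (hf : ∀ I ⊆ Iio l, ¬ I.Countable → ¬ (⋃ α ∈ I, range (f α)).Countable)
    (B : Ordinal.{u} → Set Ordinal.{u}) (hB : ∀ α < l, range (f α) ⊆ B α) :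
    IsSparseFamily ℵ₁ ℵ₁ {R | ∃ α < l, R = B α} := by
  intro 𝓖 h𝓖 hcard hsmall
  choose! g hgl hg using h𝓖
  have h𝓖c : ¬ 𝓖.Countable := by
    rwa [countable_iff_mk_lt_aleph_one, not_lt]
  refine hf (g '' 𝓖) (by rintro _ ⟨R, hR, rfl⟩; exact hgl hR) ?_ ?_
  · refine fun h => h𝓖c (countable_of_injective_of_countable_image ?_ h)
    intro R hR R' hR' heq
    rw [hg hR, hg hR', heq]
  · have hU : (⋃₀ 𝓖).Countable := countable_iff_mk_lt_aleph_one.2 hsmall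
    refine hU.mono ?_
    rw [biUnion_image]
    refine iUnion₂_subset fun R hR => (hB _ (hgl hR)).trans ?_
    rw [← hg hR]
    exact subset_sUnion_of_mem hR

theorem aleph_one_lt_cof_omega : ℵ₁ < (ω_ (ω + 1) : Ordinal.{u}).cof := by
  rw [(Cardinal.isRegular_aleph_add_one ω).cof_omega_eq, Cardinal.aleph_lt_aleph]
  exact lt_of_lt_of_le Ordinal.one_lt_omega0 le_self_add

theorem IsGoodScale.not_countable_iUnion_range {f : Ordinal.{u} → ℕ → Ordinal.{u}}
    (hf : IsGoodScale cofinite (ω_ (ω + 1)) f) :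
    ∀ I ⊆ Iio (ω_ (ω + 1)), ¬ I.Countable → ¬ (⋃ α ∈ I, range (f α)).Countable :=
  fun _ hI hIc => SparseFamily.not_countable_iUnion_range aleph_one_lt_cof_omega hf.1.2.1
    (fun β hβ hc => isWeaklyFlat_of_isFlat (hf.2 β hβ hc).1) hI hIc

/-! ### Sparse cofinal families -/

theorem exists_enumeration_of_cov_eq (hcov : cov.{u} (ℵ_ ω) ℵ₀ = ℵ_ (ω + 1)) :
    ∃ A : Ordinal.{u} → Set Ordinal.{u},
      (∀ α < ω_ (ω + 1), A α ∈ subsetsOfCard (ℵ_ ω) ℵ₀) ∧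
      ∀ X ∈ subsetsOfCard (ℵ_ ω) ℵ₀, ∃ α < ω_ (ω + 1), X ⊆ A α := by
  have hne : {c | ∃ 𝓐 : Set (Set Ordinal.{u}),
      IsCofinalFamily (ℵ_ ω) ℵ₀ 𝓐 ∧ Cardinal.mk 𝓐 = c}.Nonempty := by
    -- The infimum of the empty set is `0`, which differs from `ℵ_{ω+1}`.
    by_contra h
    have h₀ : cov.{u} (ℵ_ ω) ℵ₀ = 0 := by
      rw [cov, not_nonempty_iff_eq_empty.1 h, Cardinal.sInf_empty]
    exact (Cardinal.aleph_pos _).ne' (hcov.symm.trans h₀)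
  obtain ⟨𝓐, h𝓐, hcard⟩ := csInf_mem hne
  change #𝓐 = cov (ℵ_ ω) ℵ₀ at hcard
  have hIio : #(Iio (ω_ (ω + 1) : Ordinal.{u})) = ℵ_ (ω + 1) := by
    simp [Cardinal.mk_Iio_ordinal]
  obtain ⟨e⟩ := Cardinal.eq.1 ((hIio.trans hcov.symm).trans hcard.symm)
  classical
  refine ⟨fun α => if h : α < ω_ (ω + 1) then e ⟨α, h⟩ else ∅, fun α hα => ?_, fun X hX => ?_⟩
  · simpa only [dif_pos hα] using h𝓐.1 (e ⟨α, hα⟩).2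
  · obtain ⟨Y, hY, hXY⟩ := h𝓐.2 X hX
    have hlt : (e.symm ⟨Y, hY⟩).1 < ω_ (ω + 1) := (e.symm ⟨Y, hY⟩).2
    have heq : (e ⟨(e.symm ⟨Y, hY⟩).1, hlt⟩).1 = Y :=
      congrArg Subtype.val (e.apply_symm_apply ⟨Y, hY⟩)
    refine ⟨_, hlt, ?_⟩
    simp only [dif_pos hlt]
    rwa [heq]

theorem exists_sparse_cofinal {f : Ordinal.{u} → ℕ → Ordinal.{u}}
    (hcov : cov.{u} (ℵ_ ω) ℵ₀ = ℵ_ (ω + 1))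
    (hbd : ∀ α < ω_ (ω + 1), ∀ n, f α n < ω_ ω)
    (hf : ∀ I ⊆ Iio (ω_ (ω + 1)), ¬ I.Countable → ¬ (⋃ α ∈ I, range (f α)).Countable) :
    ∃ 𝓕 : Set (Set Ordinal.{u}), IsCofinalFamily (ℵ_ ω) ℵ₀ 𝓕 ∧ IsSparseFamily ℵ₁ ℵ₁ 𝓕 := by
  obtain ⟨A, hA, hcof⟩ := exists_enumeration_of_cov_eq hcov
  refine ⟨{R | ∃ α < ω_ (ω + 1), R = A α ∪ range (f α)}, ⟨?_, fun X hX => ?_⟩,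
    isSparseFamily_of_range_subset hf _ fun α _ => subset_union_right⟩
  · rintro _ ⟨α, hα, rfl⟩
    obtain ⟨hsub, hcard⟩ := hA α hα
    refine ⟨union_subset hsub ?_, le_antisymm ?_ ?_⟩
    · rintro _ ⟨n, rfl⟩
      rw [Cardinal.ord_aleph]
      exact hbd α hα n
    · rw [Cardinal.lift_aleph0] at hcard ⊢
      rw [Cardinal.le_aleph0_iff_set_countable]
      exact (Cardinal.le_aleph0_iff_set_countable.1 hcard.le).union (countable_range _)
    · rw [← hcard]
      exact Cardinal.mk_le_mk_of_subset subset_union_left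
  · obtain ⟨α, hα, hXα⟩ := hcof X hX
    exact ⟨_, ⟨α, hα, rfl⟩, hXα.trans subset_union_left⟩

/-! ### A sparse sequence of functions from the square principle -/

/-- An injection of `α` into `ω_ω` exists by cardinality; the sets are the preimages of the `ω_n`.
-/
theorem exists_filtration {α : Ordinal.{u}} (hα : α < ω_ (ω + 1)) :
    ∃ X : ℕ → Set Ordinal.{u}, Monotone X ∧ (∀ n : ℕ, #(X n) ≤ ℵ_ (n : Ordinal.{u + 1})) ∧
      ∀ γ < α, ∃ n, γ ∈ X n := by
  have hcard : #(Iio α) ≤ #(Iio (ω_ ω : Ordinal.{u})) := by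
    rw [Cardinal.mk_Iio_ordinal, Cardinal.mk_Iio_ordinal, Cardinal.lift_le, Ordinal.card_omega]
    rwa [Cardinal.lt_omega_iff_card_lt, ← Cardinal.succ_aleph, lt_succ_iff] at hα
  obtain ⟨e⟩ := hcard
  refine ⟨fun n => (↑) '' {γ : Iio α | (e γ).1 < ω_ (n : Ordinal.{u})}, ?_, fun n => ?_,
    fun γ hγ => ?_⟩
  · intro m n hmn
    refine image_mono fun γ (hγ : (e γ).1 < _) => lt_of_lt_of_le (b := ω_ (m : Ordinal.{u})) hγ ?_
    exact Ordinal.omega_le_omega.2 (by exact_mod_cast hmn)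
  · rw [Cardinal.mk_image_eq Subtype.val_injective]
    have h₁ : #(Iio (ω_ (n : Ordinal.{u}))) = ℵ_ (n : Ordinal.{u + 1}) := by
      simp [Cardinal.mk_Iio_ordinal]
    rw [← h₁]
    refine Cardinal.mk_le_of_injective
      (f := fun γ => (⟨(e γ.1).1, γ.2⟩ : Iio (ω_ (n : Ordinal.{u})))) fun γ δ h => ?_
    exact Subtype.ext (e.injective (Subtype.ext (Subtype.mk.inj h)))
  · have hlt : (e ⟨γ, hγ⟩).1 < ω_ ω := (e ⟨γ, hγ⟩).2
    obtain ⟨a, ha, hlt'⟩ :=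
      (Ordinal.isNormal_omega.lt_iff_exists_lt Ordinal.isSuccLimit_omega0).1 hlt
    obtain ⟨n, rfl⟩ := Ordinal.lt_omega0.1 ha
    exact ⟨n, ⟨γ, hγ⟩, hlt', rfl⟩

/-- The sequence of functions defined by the recursion
`f α n = sup {f γ n + 1 : γ ∈ S α n, γ < α}`. -/
noncomputable def recSup (S : Ordinal.{u} → ℕ → Set Ordinal.{u}) (α : Ordinal.{u}) (n : ℕ) :
    Ordinal.{u} :=
  ⨆ γ : ↥(Iio α ∩ S α n), recSup S γ.1 n + 1
termination_by α
decreasing_by exact γ.2.1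

theorem recSup_lt_recSup {S : Ordinal.{u} → ℕ → Set Ordinal.{u}} {γ α : Ordinal.{u}} {n : ℕ}
    (hγα : γ < α) (hγ : γ ∈ S α n) : recSup S γ n < recSup S α n := by
  have : Small.{u} ↥(Iio α ∩ S α n) := small_subset inter_subset_left
  rw [recSup.eq_1 S α n]
  exact Ordinal.lt_iSup_add_one (fun γ : ↥(Iio α ∩ S α n) => recSup S γ.1 n) ⟨γ, hγα, hγ⟩

/-- Each supremum has at most `ℵ_n` terms, so regularity of `ℵ_{n+1}` keeps it below `ω_{n+1}`. -/
theorem recSup_lt_omega {S : Ordinal.{u} → ℕ → Set Ordinal.{u}} {l : Ordinal.{u}} {n : ℕ}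
    (hS : ∀ α < l, #(S α n) ≤ ℵ_ (n : Ordinal.{u + 1})) (α : Ordinal.{u}) (hα : α < l) :
    recSup S α n < ω_ ((n : Ordinal.{u}) + 1) := by
  induction α using WellFoundedLT.induction with
  | ind α ih =>
    rw [recSup]
    refine Ordinal.lift_iSup_add_one_lt_of_lt_cof ?_
      fun γ : ↥(Iio α ∩ S α n) => ih γ γ.2.1 (lt_trans γ.2.1 hα)
    rw [← Ordinal.lift_cof, (Cardinal.isRegular_aleph_add_one _).cof_omega_eq]
    refine (Cardinal.lift_le.2 ((Cardinal.mk_le_mk_of_subset inter_subset_right).trans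
      (hS α hα))).trans_lt ?_
    simp

theorem exists_isLimitPoint_gt {β : Ordinal.{u}} {C : Set Ordinal.{u}} (hβ : ℵ₀ < β.cof)
    (hC : IsClubIn C β) {b : Ordinal.{u}} (hb : b < β) :
    ∃ γ < β, b < γ ∧ IsLimitPoint γ C := by
  choose! g hgC hg using hC.2.1
  have hc : ∀ k, g^[k] b < β := by
    intro k
    induction k with
    | zero => exact hb
    | succ k ih =>
      rw [Function.iterate_succ_apply']
      exact hC.1 (hgC _ ih)
  have hlt : ∀ k, g^[k] b < g^[k + 1] b := fun k => by
    rw [Function.iterate_succ_apply']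
    exact hg _ (hc k)
  obtain ⟨d, hd, hbd⟩ := exists_gt_of_countable hβ (S := range fun k => g^[k] b)
    (by rintro _ ⟨k, rfl⟩; exact hc k) (countable_range _)
  have hle : ∀ k, g^[k] b ≤ ⨆ k, g^[k] b := fun k => Ordinal.le_iSup (fun k => g^[k] b) k
  have hbs : b < ⨆ k, g^[k] b := (hlt 0).trans_le (hle 1)
  refine ⟨⨆ k, g^[k] b, (Ordinal.iSup_le fun k => (hbd _ ⟨k, rfl⟩).le).trans_lt hd, hbs,
    (bot_lt_of_lt hbs).ne', fun γ hγ => ?_⟩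
  obtain ⟨k, hk⟩ := Ordinal.lt_iSup_iff.1 hγ
  refine ⟨g^[k + 1] b, ?_, hk.trans (hlt k), (hlt (k + 1)).trans_le (hle _)⟩
  rw [Function.iterate_succ_apply']
  exact hgC _ (hc k)

/-- Order type exactly `ω_ω` would give `β` countable cofinality, so the type of `C` is below some
`ω_n`. -/
theorem exists_mk_le_aleph_of_isClubIn {β : Ordinal.{u}} {C : Set Ordinal.{u}}
    (hβ : ℵ₀ < β.cof) (hC : IsClubIn C β)
    (htype : Ordinal.type (fun x y : C => x < y) ≤ Ordinal.lift.{u + 1} (ℵ_ ω : Cardinal.{u}).ord) :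
    ∃ n : ℕ, #C ≤ ℵ_ (n : Ordinal.{u + 1}) := by
  have hcof : Order.cof C = Cardinal.lift.{u + 1} β.cof := by
    rw [Ordinal.lift_cof, ← Ordinal.cof_Iio]
    refine Order.cof_congr_of_strictMono (f := fun x : C => (⟨x.1, hC.1 x.2⟩ : Iio β))
      (fun x y h => h) fun b => ?_
    obtain ⟨c, hc, hbc⟩ := hC.2.1 b.1 b.2
    exact ⟨_, ⟨⟨c, hc⟩, rfl⟩, hbc.le⟩
  have hlift : Ordinal.lift.{u + 1} (ℵ_ ω : Cardinal.{u}).ord = ω_ ω := by simp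
  rw [hlift] at htype
  have hlt : Ordinal.type (fun x y : C => x < y) < ω_ ω := by
    refine htype.lt_of_ne fun heq => ?_
    have h₁ : Order.cof C = ℵ₀ := by
      rw [← Ordinal.cof_type, heq, Ordinal.cof_omega Ordinal.isSuccLimit_omega0,
        Ordinal.cof_omega0]
    rw [hcof] at h₁
    exact hβ.ne' (Cardinal.lift_eq_aleph0.1 h₁)
  obtain ⟨a, ha, hlt'⟩ :=
    (Ordinal.isNormal_omega.lt_iff_exists_lt Ordinal.isSuccLimit_omega0).1 hlt
  obtain ⟨n, rfl⟩ := Ordinal.lt_omega0.1 ha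
  rw [Cardinal.lt_omega_iff_card_lt, Ordinal.card_type] at hlt'
  exact ⟨n, hlt'.le⟩

theorem exists_sparse_sequence_of_square (hsq : SquarePrinciple.{u} (ℵ_ ω)) :
    ∃ f : Ordinal.{u} → ℕ → Ordinal.{u}, (∀ α < ω_ (ω + 1), ∀ n, f α n < ω_ ω) ∧
      ∀ I ⊆ Iio (ω_ (ω + 1)), ¬ I.Countable → ¬ (⋃ α ∈ I, range (f α)).Countable := by
  obtain ⟨C, hC⟩ := hsq
  rw [Cardinal.succ_aleph, Cardinal.ord_aleph] at hC
  choose! X hXmono hXcard hX using fun α (hα : α < (ω_ (ω + 1) : Ordinal.{u})) =>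
    exists_filtration hα
  -- The filtration `X α` makes the recursion `<*`-increasing; `C α` provides flatness. It enters
  -- only at coordinates where it has size at most `ℵ_n`, so that `S α n` does too.
  let S : Ordinal.{u} → ℕ → Set Ordinal.{u} := fun α n =>
    X α n ∪ {γ | γ ∈ C α ∧ #(C α) ≤ ℵ_ (n : Ordinal.{u + 1})}
  have hScard : ∀ n : ℕ, ∀ α < ω_ (ω + 1), #(S α n) ≤ ℵ_ (n : Ordinal.{u + 1}) := by
    intro n α hα
    refine (Cardinal.mk_union_le _ _).trans
      (Cardinal.add_le_of_le (Cardinal.aleph0_le_aleph _) (hXcard α hα n) ?_)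
    by_cases h : #(C α) ≤ ℵ_ (n : Ordinal.{u + 1})
    · exact (Cardinal.mk_le_mk_of_subset fun γ hγ => hγ.1).trans h
    · simp [h]
  have hinc : IsIncreasingMod cofinite (ω_ (ω + 1)) (recSup S) := by
    intro γ α hγα hα
    obtain ⟨N, hN⟩ := hX α hα γ hγα
    rw [ltMod, Nat.cofinite_eq_atTop]
    filter_upwards [eventually_ge_atTop N] with n hn
    exact recSup_lt_recSup hγα (Or.inl (hXmono α hα hn hN))
  refine ⟨recSup S, fun α hα n => (recSup_lt_omega (hScard n) α hα).trans ?_, fun I =>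
    not_countable_iUnion_range aleph_one_lt_cof_omega hinc fun β hβ hcof => ?_⟩
  · rw [Ordinal.omega_lt_omega]
    exact_mod_cast Ordinal.natCast_lt_omega0 (n + 1)
  have hβlim : IsSuccLimit β :=
    Ordinal.one_lt_cof_iff.1 (Cardinal.one_lt_aleph0.trans hcof)
  obtain ⟨hclub, htype, hcoh⟩ := hC β hβ hβlim
  obtain ⟨N, hN⟩ := exists_mk_le_aleph_of_isClubIn hcof hclub htype
  -- The functions at limit points of `C β` serve as the interleaved family. If `γ < δ` are limit
  -- points, coherence gives `γ ∈ C δ ⊆ C β`, and `N` bounds the size of all these `C δ` at once, so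
  -- the increase holds at every `n ≥ N`.
  refine ⟨{γ | γ < β ∧ IsLimitPoint γ (C β)}, N, recSup S, fun T hT hTc => ?_, ?_, ?_, ?_⟩
  · obtain ⟨b, hb, hTb⟩ := exists_gt_of_countable hcof (fun i hi => (hT hi).1) hTc
    obtain ⟨γ, hγ, hbγ, hlim⟩ := exists_isLimitPoint_gt hcof hclub hb
    exact ⟨γ, ⟨hγ, hlim⟩, fun i hi => ((hTb i hi).trans hbγ).le⟩
  · rintro γ ⟨hγ, hγlim⟩ δ ⟨hδ, hδlim⟩ hle n hn
    rcases hle.eq_or_lt with rfl | hlt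
    · exact le_rfl
    have heq : C δ = C β ∩ Iio δ := hcoh δ hδ hδlim
    refine (recSup_lt_recSup hlt (Or.inr ⟨?_, ?_⟩)).le
    · rw [heq]
      exact ⟨hclub.2.2 γ hγ hγlim, hlt⟩
    · rw [heq]
      refine (Cardinal.mk_le_mk_of_subset inter_subset_left).trans (hN.trans ?_)
      exact Cardinal.aleph_le_aleph.2 (by exact_mod_cast hn)
  · rintro γ ⟨hγ, -⟩
    exact ⟨γ + 1, hβlim.succ_lt hγ, hinc _ _ (lt_add_one γ) ((hβlim.succ_lt hγ).trans hβ)⟩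
  · intro α hα
    obtain ⟨γ, hγ, hαγ, hlim⟩ := exists_isLimitPoint_gt hcof hclub hα
    exact ⟨γ, ⟨hγ, hlim⟩, hinc _ _ hαγ (hγ.trans hβ)⟩

/-! ### The Noetherian type of the `G_δ`-modification of a Cantor cube -/

/-- The set of points agreeing with `x` on `Y`. -/
def cylinder {ι : Type v} (Y : Set ι) (x : ι → Bool) : Set (ι → Bool) :=
  {y | ∀ i ∈ Y, y i = x i}

theorem self_mem_cylinder {ι : Type v} (Y : Set ι) (x : ι → Bool) : x ∈ cylinder Y x :=
  fun _ _ => rfl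

theorem cylinder_eq_of_mem {ι : Type v} {Y : Set ι} {x y : ι → Bool} (h : y ∈ cylinder Y x) :
    cylinder Y x = cylinder Y y := by
  ext z
  exact forall₂_congr fun i hi => by rw [h i hi]

/-- Flipping a coordinate outside `Y` stays in the first cylinder, so the second cannot constrain
that coordinate. -/
theorem subset_of_cylinder_subset {ι : Type v} {Y Z : Set ι} {x z : ι → Bool}
    (h : cylinder Y x ⊆ cylinder Z z) : Z ⊆ Y := by
  classical
  intro i hi
  by_contra hiY
  have h₁ : Function.update x i (!x i) ∈ cylinder Y x := fun k hk =>
    Function.update_of_ne (by rintro rfl; exact hiY hk) _ _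
  have h₂ := h h₁ i hi
  have h₃ := h (self_mem_cylinder Y x) i hi
  rw [Function.update_self, ← h₃] at h₂
  exact Bool.not_ne_self _ h₂

theorem isOpen_deltaModification_iff {ι : Type v} {U : Set (ι → Bool)} :
    IsOpen[deltaModification (Pi.topologicalSpace : TopologicalSpace (ι → Bool))] U ↔
      ∀ x ∈ U, ∃ Y : Set ι, Y.Countable ∧ cylinder Y x ⊆ U := by
  constructor
  · intro hU
    induction hU with
    | basic s hs =>
      obtain ⟨𝓢, hopen, hcard, rfl⟩ := hs
      intro x hx
      have hc : 𝓢.Countable := countable_iff_mk_lt_aleph_one.2 hcard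
      have key : ∀ V ∈ 𝓢, ∃ Y : Set ι, Y.Countable ∧ cylinder Y x ⊆ V := by
        intro V hV
        obtain ⟨I, w, hw, hsub⟩ := isOpen_pi_iff.1 (hopen V hV) x (hx V hV)
        refine ⟨I, I.countable_toSet, fun y hy => hsub fun i hi => ?_⟩
        rw [hy i hi]
        exact (hw i hi).2
      choose! Y hYc hY using key
      refine ⟨⋃ V ∈ 𝓢, Y V, hc.biUnion hYc, fun y hy V hV => hY V hV fun i hi => ?_⟩
      exact hy i (mem_biUnion hV hi)
    | univ => exact fun x _ => ⟨∅, countable_empty, subset_univ _⟩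
    | inter s t _ _ hs ht =>
      intro x hx
      obtain ⟨Y, hYc, hY⟩ := hs x hx.1
      obtain ⟨Z, hZc, hZ⟩ := ht x hx.2
      exact ⟨Y ∪ Z, hYc.union hZc, fun y hy =>
        ⟨hY fun i hi => hy i (Or.inl hi), hZ fun i hi => hy i (Or.inr hi)⟩⟩
    | sUnion S _ hS =>
      rintro x ⟨s, hs, hx⟩
      obtain ⟨Y, hYc, hY⟩ := hS s hs x hx
      exact ⟨Y, hYc, hY.trans (subset_sUnion_of_mem hs)⟩
  · intro h
    rw [@isOpen_iff_forall_mem_open]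
    intro x hx
    obtain ⟨Y, hYc, hY⟩ := h x hx
    refine ⟨cylinder Y x, hY, TopologicalSpace.GenerateOpen.basic _ ?_, self_mem_cylinder Y x⟩
    refine ⟨(fun i => {y : ι → Bool | y i = x i}) '' Y, ?_, ?_, ?_⟩
    · rintro _ ⟨i, -, rfl⟩
      exact (isOpen_discrete ({x i} : Set Bool)).preimage (continuous_apply (A := fun _ => Bool) i)
    · exact countable_iff_mk_lt_aleph_one.1 (hYc.image _)
    · ext y
      simp [cylinder]

theorem isOpen_cylinder {ι : Type v} {Y : Set ι} (hY : Y.Countable) (x : ι → Bool) :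
    IsOpen[deltaModification (Pi.topologicalSpace : TopologicalSpace (ι → Bool))]
      (cylinder Y x) :=
  isOpen_deltaModification_iff.2 fun _ hy => ⟨Y, hY, (cylinder_eq_of_mem hy).superset⟩

theorem isOpen_sInter_deltaModification {ι : Type v} {𝓢 : Set (Set (ι → Bool))}
    (hc : 𝓢.Countable)
    (hopen : ∀ U ∈ 𝓢,
      IsOpen[deltaModification (Pi.topologicalSpace : TopologicalSpace (ι → Bool))] U) :
    IsOpen[deltaModification (Pi.topologicalSpace : TopologicalSpace (ι → Bool))] (⋂₀ 𝓢) := by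
  rw [isOpen_deltaModification_iff]
  intro x hx
  choose! Y hYc hY using fun U (hU : U ∈ 𝓢) =>
    isOpen_deltaModification_iff.1 (hopen U hU) x (hx U hU)
  exact ⟨⋃ U ∈ 𝓢, Y U, hc.biUnion hYc,
    fun y hy U hU => hY U hU fun i hi => hy i (mem_biUnion hU hi)⟩

theorem not_isOpLike_aleph0 {ι : Type v} [Uncountable ι] {𝓑 : Set (Set (ι → Bool))}
    (hB : TopologicalSpace.IsTopologicalBasis
      (t := deltaModification (Pi.topologicalSpace : TopologicalSpace (ι → Bool))) 𝓑) :
    ¬ IsOpLike ℵ₀ 𝓑 := by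
  classical
  intro hop
  let x : ι → Bool := fun _ => false
  have hopen : ∀ U ∈ 𝓑,
      IsOpen[deltaModification (Pi.topologicalSpace : TopologicalSpace (ι → Bool))] U :=
    fun U hU => @TopologicalSpace.IsTopologicalBasis.isOpen _ (_) _ _ hB hU
  have hbase : ∀ U : Set (ι → Bool),
      IsOpen[deltaModification (Pi.topologicalSpace : TopologicalSpace (ι → Bool))] U →
      x ∈ U → ∃ V ∈ 𝓑, x ∈ V ∧ V ⊆ U :=
    fun U hU hx =>
      @TopologicalSpace.IsTopologicalBasis.exists_subset_of_mem_open _ (_) _ hB _ _ hx hU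
  let 𝓝x : Set (Set (ι → Bool)) := {V | V ∈ 𝓑 ∧ x ∈ V}
  -- Finitely many basic neighbourhoods would have an intersection containing a cylinder with
  -- countable support; a coordinate outside that support could be flipped within it, yet some basic
  -- neighbourhood fixes it.
  have hinf : 𝓝x.Infinite := by
    intro hfin
    obtain ⟨Y, hYc, hY⟩ := isOpen_deltaModification_iff.1
      (isOpen_sInter_deltaModification hfin.countable fun U hU => hopen U hU.1) x
      fun U hU => hU.2
    obtain ⟨i, hi⟩ : ∃ i, i ∉ Y := by
      by_contra! h
      exact not_countable_univ (hYc.mono fun i _ => h i)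
    obtain ⟨V, hV, hxV, hVi⟩ := hbase _ (isOpen_cylinder (countable_singleton i) x)
      (self_mem_cylinder _ x)
    have hy : Function.update x i true ∈ cylinder Y x := fun k hk =>
      Function.update_of_ne (by rintro rfl; exact hi hk) _ _
    have := hVi (hY hy V ⟨hV, hxV⟩) i rfl
    simp [x] at this
  obtain ⟨𝓢, hsub, h𝓢⟩ := Cardinal.le_mk_iff_exists_subset.1
    (Cardinal.aleph0_le_mk_iff.2 (infinite_coe_iff.2 hinf))
  have h𝓢c : 𝓢.Countable := Cardinal.le_aleph0_iff_set_countable.1 h𝓢.le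
  have h𝓢inf : 𝓢.Infinite := infinite_coe_iff.1 (Cardinal.aleph0_le_mk_iff.1 h𝓢.ge)
  -- A countably infinite set of neighbourhoods has open intersection, so a basic `V` inside it has
  -- infinitely many supersets in the base.
  obtain ⟨V, hV, -, hVs⟩ := hbase _
    (isOpen_sInter_deltaModification h𝓢c fun U hU => hopen U (hsub hU).1)
    fun U hU => (hsub hU).2
  refine h𝓢inf ((Cardinal.lt_aleph0_iff_set_finite.1 (hop V hV)).subset fun U hU => ?_)
  exact ⟨(hsub hU).1, fun y hy => hVs hy U hU⟩

theorem noetherianType_eq_aleph_one {ι : Type v} [Uncountable ι] {𝓕 : Set (Set ι)}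
    (hc : ∀ Y ∈ 𝓕, Y.Countable) (hcof : ∀ X : Set ι, X.Countable → ∃ Y ∈ 𝓕, X ⊆ Y)
    (hsparse : ∀ Y ∈ 𝓕, {Z | Z ∈ 𝓕 ∧ Z ⊆ Y}.Countable) :
    noetherianType
      (deltaModification (Pi.topologicalSpace : TopologicalSpace (ι → Bool))) = ℵ₁ := by
  have hmem : ℵ₁ ∈ {κ | ℵ₀ ≤ κ ∧ ∃ 𝓑 : Set (Set (ι → Bool)),
      TopologicalSpace.IsTopologicalBasis
        (t := deltaModification (Pi.topologicalSpace : TopologicalSpace (ι → Bool))) 𝓑 ∧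
      IsOpLike κ 𝓑} := by
    refine ⟨Cardinal.aleph0_le_aleph 1, {B | ∃ Y ∈ 𝓕, ∃ x, B = cylinder Y x}, ?_, ?_⟩
    · refine @TopologicalSpace.isTopologicalBasis_of_isOpen_of_nhds _ (_) _ ?_ ?_
      · rintro _ ⟨Y, hY, x, rfl⟩
        exact isOpen_cylinder (hc Y hY) x
      · intro x U hx hU
        obtain ⟨X, hXc, hX⟩ := isOpen_deltaModification_iff.1 hU x hx
        obtain ⟨Y, hY, hXY⟩ := hcof X hXc
        exact ⟨cylinder Y x, ⟨Y, hY, x, rfl⟩, self_mem_cylinder Y x,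
          fun y hy => hX fun i hi => hy i (hXY hi)⟩
    · rintro _ ⟨Y, hY, x, rfl⟩
      rw [← countable_iff_mk_lt_aleph_one]
      -- A cylinder containing `cylinder Y x` is centred at `x` without loss of generality, so its
      -- support determines it.
      refine ((hsparse Y hY).image fun Z => cylinder Z x).mono ?_
      rintro _ ⟨⟨Z, hZ, z, rfl⟩, hsub⟩
      exact ⟨Z, ⟨hZ, subset_of_cylinder_subset hsub⟩,
        (cylinder_eq_of_mem (hsub (self_mem_cylinder Y x))).symm⟩
  refine le_antisymm (csInf_le' hmem) (le_csInf ⟨_, hmem⟩ ?_)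
  rintro κ ⟨hκ, 𝓑, hB, hop⟩
  rw [Cardinal.aleph_one_le_iff]
  refine hκ.lt_of_ne ?_
  rintro rfl
  exact not_isOpLike_aleph0 hB hop

theorem noetherianType_cantorCube_eq_aleph_one {κ : Cardinal.{u}} (hκ : ℵ₀ < κ)
    {𝓕 : Set (Set Ordinal.{u})} (hcof : IsCofinalFamily κ ℵ₀ 𝓕)
    (hsparse : IsSparseFamily ℵ₁ ℵ₁ 𝓕) :
    noetherianType
      (deltaModification (Pi.topologicalSpace : TopologicalSpace (CantorCube.{u} κ))) = ℵ₁ := by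
  have hmk : #(Iio κ.ord) = Cardinal.lift.{u + 1} κ := by simp [Cardinal.mk_Iio_ordinal]
  have hunc : Uncountable (Iio κ.ord) := by
    rw [← Cardinal.aleph0_lt_mk_iff, hmk]
    simpa using hκ
  have h𝓕c : ∀ Y ∈ 𝓕, Y.Countable := fun Y hY => by
    rw [← Cardinal.le_aleph0_iff_set_countable, (hcof.1 hY).2, Cardinal.lift_aleph0]
  refine noetherianType_eq_aleph_one
    (𝓕 := (fun Y => ((↑) : Iio κ.ord → Ordinal.{u}) ⁻¹' Y) '' 𝓕) ?_ ?_ ?_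
  · rintro _ ⟨Y, hY, rfl⟩
    exact (h𝓕c Y hY).preimage Subtype.val_injective
  · intro X hX
    -- Members of `[κ]^{ℵ₀}` have size exactly `ℵ₀`, so a possibly finite `X` is padded by a
    -- countably infinite set.
    obtain ⟨X₀, -, hX₀⟩ := Cardinal.le_mk_iff_exists_subset.1
      (show ℵ₀ ≤ #(univ : Set (Iio κ.ord)) by
        rw [Cardinal.mk_univ, hmk]; simpa using hκ.le)
    have hmem : ((↑) '' (X ∪ X₀) : Set Ordinal.{u}) ∈ subsetsOfCard κ ℵ₀ := by
      refine ⟨by rintro _ ⟨i, -, rfl⟩; exact i.2, ?_⟩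
      rw [Cardinal.mk_image_eq Subtype.val_injective, Cardinal.lift_aleph0]
      refine le_antisymm ?_ ?_
      · rw [Cardinal.le_aleph0_iff_set_countable]
        exact hX.union (Cardinal.le_aleph0_iff_set_countable.1 hX₀.le)
      · rw [← hX₀]
        exact Cardinal.mk_le_mk_of_subset subset_union_right
    obtain ⟨Y, hY, hXY⟩ := hcof.2 _ hmem
    exact ⟨_, ⟨Y, hY, rfl⟩, fun i hi => hXY ⟨i, Or.inl hi, rfl⟩⟩
  · rintro _ ⟨Y, hY, rfl⟩
    -- Uncountably many members inside the countable set `Y` would have a countable union.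
    have hcount : {Z | Z ∈ 𝓕 ∧ Z ⊆ Y}.Countable := by
      by_contra h
      rw [countable_iff_mk_lt_aleph_one, not_lt] at h
      refine hsparse _ (fun Z hZ => hZ.1) h ?_
      exact countable_iff_mk_lt_aleph_one.1
        ((h𝓕c Y hY).mono (sUnion_subset fun Z hZ => hZ.2))
    refine (hcount.image fun Z => ((↑) : Iio κ.ord → Ordinal.{u}) ⁻¹' Z).mono ?_
    rintro _ ⟨⟨Z, hZ, rfl⟩, hsub⟩
    exact ⟨Z, ⟨hZ, fun a ha => hsub (show (⟨a, (hcof.1 hZ).1 ha⟩ : Iio κ.ord) ∈ _ from ha)⟩, rfl⟩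

end SparseFamily

theorem mainTheorem9 :
    -- the ranges of any good scale of length `ℵ_{ω+1}` form an `(ℵ₁, ℵ₁)`-sparse family
    (∀ f : Ordinal.{u} → ℕ → Ordinal.{u},
      IsGoodScale Filter.cofinite (ω_ (ω + 1)) f →
        IsSparseFamily ℵ₁ ℵ₁ {R | ∃ α < ω_ (ω + 1), R = Set.range (f α)}) ∧
    -- a good scale and `cov(ℵ_ω, ℵ₀) = ℵ_{ω+1}` give an `(ℵ₁, ℵ₁)`-sparse cofinal family
    (cov.{u} (ℵ_ ω) ℵ₀ = ℵ_ (ω + 1) →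
      (∃ f : Ordinal.{u} → ℕ → Ordinal.{u}, IsGoodScale Filter.cofinite (ω_ (ω + 1)) f) →
        ∃ 𝓕 : Set (Set Ordinal.{u}),
          IsCofinalFamily (ℵ_ ω) ℵ₀ 𝓕 ∧ IsSparseFamily ℵ₁ ℵ₁ 𝓕) ∧
    -- `□_{ℵ_ω}` and `cov(ℵ_ω, ℵ₀) = ℵ_{ω+1}` determine the Noetherian type of `(2^{ℵ_ω})_δ`
    (SquarePrinciple.{u} (ℵ_ ω) → cov.{u} (ℵ_ ω) ℵ₀ = ℵ_ (ω + 1) →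
      noetherianType
        (deltaModification (Pi.topologicalSpace : TopologicalSpace (CantorCube.{u} (ℵ_ ω)))) = ℵ₁) := by
  refine ⟨fun f hf => ?_, fun hcov ⟨f, hf⟩ => ?_, fun hsq hcov => ?_⟩
  · exact SparseFamily.isSparseFamily_of_range_subset
      (SparseFamily.IsGoodScale.not_countable_iUnion_range hf) (fun α => Set.range (f α))
      fun _ _ => subset_rfl
  · refine SparseFamily.exists_sparse_cofinal hcov (fun α hα n => (hf.1.1 α hα n).trans ?_)
      (SparseFamily.IsGoodScale.not_countable_iUnion_range hf)
    exact Ordinal.omega_lt_omega.2 (Ordinal.natCast_lt_omega0 n)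
  · obtain ⟨f, hbd, hf⟩ := SparseFamily.exists_sparse_sequence_of_square hsq
    obtain ⟨𝓕, hcof, hsparse⟩ := SparseFamily.exists_sparse_cofinal hcov hbd hf
    refine SparseFamily.noetherianType_cantorCube_eq_aleph_one ?_ hcof hsparse
    exact Cardinal.aleph0_lt_aleph.2 Ordinal.omega0_pos
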